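/- An $m$-dimensional reproducing kernel Hilbert space (RKHS) is an $m$-dimensional complex inner product space $H$ together with a distinguished basis $k_1,\dots,k_m$ (the reproducing kernels), attached to points $x_1,\dots,x_m$; a vector $h\in H$ is regarded as the function $h(x_i)=\langle h,k_i\rangle$ on $X(H)=\{x_1,\dots,x_m\}$. Write $k_{ij}=\langle k_i,k_j\rangle$ and assume, as always for these spaces, that $H$ is irreducible, i.e. $k_{ij}\neq 0$ for all $i,j$. Put $$\delta_{ij}=\Bigl(1-\frac{|k_{ij}|^2}{k_{ii}k_{jj}}\Bigr)^{1/2},\qquad LF_{ijk}=\frac1{\delta_{ij}}\left|1-\frac{k_{ji}k_{ik}}{k_{jk}k_{ii}}\right| .$$ For a set $\Lambda$ of indices let $H(\Lambda)$ be the span of $\{k_i\}_{i\in\Lambda}$, an RKHS with these kernels. For a matrix-valued function $F:X(H)\to\mathbb C^{s\times t}$ let $M_F:H\otimes\mathbb C^t\to H\otimes\mathbb C^s$ be the multiplier operator $(M_Fh)(x)=F(x)h(x)$, with its operator norm. $H$ has the complete Pick property (CPP) if, for every set $\Lambda$ of indices and all $s,t$, every $F:X(H(\Lambda))\to\mathbb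 C^{s\times t}$ whose multiplier operator on $H(\Lambda)$ has norm $1$ extends to a function $G:X(H)\to\mathbb C^{s\times t}$ whose multiplier operator on $H$ has norm $1$. Two RKHS $H,\widetilde H$ with kernels $k_x$, $\tilde k_y$ are rescalings of each other, $H\sim\widetilde H$, if there are a bijection $\Xi:X(H)\to X(\widetilde H)$ and a nowhere vanishing function $\gamma:X(H)\to\mathbb C$ with $\langle\tilde k_{\Xi(x)},\tilde k_{\Xi(y)}\rangle=\gamma(x)\overline{\gamma(y)}\langle k_x,k_y\rangle$ for all $x,y\in X(H)$. Finally, for a finite subset $Y$ of the open unit disk $\mathbb D\subset\mathbb C$, let $DA_1(Y)$ be the span, in the Hardy space $DA_1=H^2$ of the disk, of the kernels $k_y(z)=(1-\bar y z)^{-1}$, $y\in Y$, an RKHS with point set $Y$. **Proposition 6.10.** Let $H$ be an irreducible $m$-dimensional RKHS with $m\ge 4$, and suppose that $H(\Lambda)$ has the CPP for every four-element set $\Lambda\subset\{1,\dots,m\}$. Then $H\sim DA_1(Y)$ for some finite $Y\subset\mathbb D$ (that is, $H$ is an r-Pick space) if and only if $LF_{ijk}=\delta_{ik}$ for all $1\le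 i<j<k\le m$. -/

import Mathlib

namespace FinRKHS

open scoped ComplexConjugate

/-! A finite dimensional reproducing kernel Hilbert space is a complex inner product space `H`
together with a distinguished basis `k`, the reproducing kernels. The index type `ι` of the basis
is the point set `X(H)`, and `h ∈ H` is the function `i ↦ ⟨h, k i⟩` on it. Mathlib's `inner ℂ` is
linear in the second argument, so `⟨u, v⟩` (linear in `u`) is `inner ℂ v u`. -/

section Basic

variable {ι H : Type*} [NormedAddCommGroup H] [InnerProductSpace ℂ H]

/-- The Gram matrix entry `k_ij = ⟨k_i, k_j⟩ = k_i(x_j)`. -/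
noncomputable def gram (k : Module.Basis ι ℂ H) (i j : ι) : ℂ := inner ℂ (k j) (k i)

/-- No two kernel functions are orthogonal. (Distinct ones are linearly independent since `k` is a
basis.) -/
def IsIrreducible (k : Module.Basis ι ℂ H) : Prop := ∀ i j, i ≠ j → gram k i j ≠ 0

/-- The distance `δ_ij`, the nonnegative root of `1 - |k_ij|² / (k_ii k_jj)`. -/
noncomputable def delta (k : Module.Basis ι ℂ H) (i j : ι) : ℝ :=
  Real.sqrt (1 - ‖gram k i j‖ ^ 2 / ((gram k i i).re * (gram k j j).re))

/-- The invariant `LF_ijl = |1 - k_ji k_il / (k_jl k_ii)| / δ_ij`. -/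
noncomputable def LF (k : Module.Basis ι ℂ H) (i j l : ι) : ℝ :=
  (1 / delta k i j) * ‖1 - (gram k j i * gram k i l) / (gram k j l * gram k i i)‖

/-- Evaluation of the elements of `H` as functions on the point set: `h ↦ (i ↦ ⟨h, k i⟩)`. -/
noncomputable def evalLin (k : Module.Basis ι ℂ H) : H →ₗ[ℂ] (ι → ℂ) where
  toFun h i := inner ℂ (k i) h
  map_add' f g := by ext i; exact inner_add_right _ _ _
  map_smul' c f := by ext i; exact inner_smul_right _ _ _

theorem evalLin_injective (k : Module.Basis ι ℂ H) : Function.Injective (evalLin k) := by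
  intro f g h
  rw [← sub_eq_zero, ← inner_self_eq_zero (𝕜 := ℂ)]
  have h0 : ∀ i, inner ℂ (k i) (f - g) = 0 := fun i => by
    rw [inner_sub_right]; exact sub_eq_zero.2 (congrFun h i)
  have h1 : ∀ v : H, inner ℂ v (f - g) = 0 := fun v => by
    have hv : v ∈ Submodule.span ℂ (Set.range k) := k.mem_span v
    induction hv using Submodule.span_induction with
    | mem x hx => obtain ⟨i, rfl⟩ := hx; exact h0 i
    | zero => exact inner_zero_left _
    | add x y _ _ hx hy => rw [inner_add_left, hx, hy, add_zero]
    | smul a x _ hx => rw [inner_smul_left, hx, mul_zero]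
  exact h1 _

theorem evalLin_bijective [Finite ι] (k : Module.Basis ι ℂ H) :
    Function.Bijective (evalLin k) := by
  have := Fintype.ofFinite ι
  have : FiniteDimensional ℂ H := k.finiteDimensional_of_finite
  refine ⟨evalLin_injective k, ?_⟩
  refine (LinearMap.injective_iff_surjective_of_finrank_eq_finrank ?_).1 (evalLin_injective k)
  rw [Module.finrank_eq_card_basis k, Module.finrank_fintype_fun_eq_card]

/-- Every function on the point set is the function of exactly one element of `H`. -/
noncomputable def evalEquiv [Finite ι] (k : Module.Basis ι ℂ H) : H ≃ₗ[ℂ] (ι → ℂ) :=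
  LinearEquiv.ofBijective (evalLin k) (evalLin_bijective k)

/-- The multiplier operator of a matrix valued symbol `F`, from `H ⊗ ℂ^t` to `H ⊗ ℂ^s` (Hilbert
direct sums of copies of `H`): it sends the `ℂ^t`-valued function `h` to the `ℂ^s`-valued function
`i ↦ F(i) h(i)`. For `s = t = 1` this is the scalar multiplier operator. -/
noncomputable def multOp [Finite ι] (k : Module.Basis ι ℂ H) {s t : ℕ}
    (F : ι → Matrix (Fin s) (Fin t) ℂ) :
    PiLp 2 (fun _ : Fin t => H) →ₗ[ℂ] PiLp 2 (fun _ : Fin s => H) where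
  toFun h := WithLp.toLp 2 fun a =>
    (evalEquiv k).symm fun i => (F i).mulVec (fun b => evalEquiv k (h b) i) a
  map_add' f g := by
    ext a
    simp only [PiLp.add_apply, map_add, Pi.add_apply]
    rw [← map_add]
    congr 1
    ext i
    exact congrFun (Matrix.mulVec_add (F i) (fun b => evalEquiv k (f b) i) _) a
  map_smul' c f := by
    ext a
    simp only [PiLp.smul_apply, map_smul, RingHom.id_apply]
    rw [← map_smul]
    congr 1
    ext i
    exact congrFun (Matrix.mulVec_smul (F i) c (fun b => evalEquiv k (f b) i)) a

/-- The operator norm of the multiplier operator with symbol `F`. -/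
noncomputable def multNorm [Finite ι] (k : Module.Basis ι ℂ H) {s t : ℕ}
    (F : ι → Matrix (Fin s) (Fin t) ℂ) : ℝ :=
  haveI : FiniteDimensional ℂ H := k.finiteDimensional_of_finite
  ‖LinearMap.toContinuousLinearMap (multOp k F)‖

/-- The kernels of `H(Y)`, the subspace spanned by the kernels `k y` with `y ∈ Y`, with point set
`Y`. -/
noncomputable def sub (k : Module.Basis ι ℂ H) (Y : Set ι) :
    Module.Basis Y ℂ (Submodule.span ℂ (Set.range fun y : Y => k y)) :=
  Module.Basis.span (k.linearIndependent.comp _ Subtype.val_injective)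

theorem coe_sub_apply (k : Module.Basis ι ℂ H) (Y : Set ι) (y : Y) :
    ((sub k Y y : Submodule.span ℂ (Set.range fun y : Y => k y)) : H) = k y :=
  congrArg Subtype.val (Module.Basis.span_apply _ y)

/-- The complete Pick property: every matrix valued multiplier of norm one on a subspace spanned by
kernel functions extends to a multiplier of norm one on the whole space. -/
def HasCPP [Finite ι] (k : Module.Basis ι ℂ H) : Prop :=
  ∀ (Y : Set ι) (s t : ℕ) (F : Y → Matrix (Fin s) (Fin t) ℂ), multNorm (sub k Y) F = 1 →
    ∃ G : ι → Matrix (Fin s) (Fin t) ℂ, (∀ y : Y, G y = F y) ∧ multNorm k G = 1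

/-- The space with kernels `k'` is a rescaling of the space with kernels `k`. -/
def IsRescaling {ι' H' : Type*} [NormedAddCommGroup H'] [InnerProductSpace ℂ H']
    (k : Module.Basis ι ℂ H) (k' : Module.Basis ι' ℂ H') : Prop :=
  ∃ (Ξ : ι ≃ ι') (γ : ι → ℂ), (∀ x, γ x ≠ 0) ∧
    ∀ x y, gram k' (Ξ x) (Ξ y) = γ x * conj (γ y) * gram k x y

end Basic

/-! The space `DA₁` is the Hardy space `H²` of the disk: the holomorphic functions
`z ↦ ∑ aₙ zⁿ` with square summable coefficients `a`, which we represent by their coefficients. -/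

section Hardy

/-- `DA₁`, the Hardy space of the disk, as the space of Taylor coefficient sequences. -/
abbrev DA1 : Type := lp (fun _ : ℕ => ℂ) 2

theorem memlp_szego (z : Complex.UnitDisc) :
    Memℓp (fun n : ℕ => conj (z : ℂ) ^ n) 2 := by
  refine (memℓp_gen_iff (by norm_num)).2 ?_
  have h : ∀ n : ℕ, ‖conj (z : ℂ) ^ n‖ ^ (2 : ENNReal).toReal = (‖(z : ℂ)‖ ^ 2) ^ n := by
    intro n
    rw [norm_pow, RCLike.norm_conj]
    norm_num
    rw [← pow_mul, ← pow_mul, mul_comm]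
  simp_rw [h]
  exact summable_geometric_of_lt_one (by positivity) z.sq_norm_lt_one

/-- The reproducing kernel `k_z(w) = 1 / (1 - w * conj z)` of `DA₁`, whose Taylor coefficients are
`conj z ^ n`. -/
noncomputable def szego (z : Complex.UnitDisc) : DA1 := ⟨_, memlp_szego z⟩

/-- The reproducing property: `⟨f, k_z⟩` is the value `f(z)`. -/
theorem inner_szego (z : Complex.UnitDisc) (f : DA1) :
    inner ℂ (szego z) f = ∑' n : ℕ, f n * (z : ℂ) ^ n := by
  rw [lp.inner_eq_tsum]
  simp [szego]

theorem inner_szego_szego (z w : Complex.UnitDisc) :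
    inner ℂ (szego w) (szego z) = 1 / (1 - (w : ℂ) * conj (z : ℂ)) := by
  rw [inner_szego, one_div, ← tsum_geometric_of_norm_lt_one]
  · congr 1
    ext n
    simp [szego, mul_pow, mul_comm]
  · rw [norm_mul, RCLike.norm_conj]
    exact mul_lt_one_of_nonneg_of_lt_one_left (norm_nonneg _) w.norm_lt_one z.norm_lt_one.le

theorem linearIndependent_szego : LinearIndependent ℂ szego := by
  have h0 : LinearIndependent ℂ fun z : Complex.UnitDisc =>
      (powersHom ℂ (conj (z : ℂ)) : Multiplicative ℕ → ℂ) := by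
    refine (linearIndependent_monoidHom (Multiplicative ℕ) ℂ).comp
      (fun z : Complex.UnitDisc => powersHom ℂ (conj (z : ℂ))) ?_
    intro z w h
    have h1 := (powersHom ℂ).injective h
    exact Complex.UnitDisc.coe_injective (star_injective h1)
  let L : DA1 →ₗ[ℂ] (Multiplicative ℕ → ℂ) :=
    { toFun := fun f n => f n.toAdd
      map_add' := fun _ _ => rfl
      map_smul' := fun _ _ => rfl }
  exact LinearIndependent.of_comp L h0

/-- The kernels of `DA₁(Y)`, the subspace of `DA₁` spanned by the kernels `k_y` with `y ∈ Y`. -/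
noncomputable def da1 (Y : Finset Complex.UnitDisc) :
    Module.Basis Y ℂ (Submodule.span ℂ (Set.range fun y : Y => szego y)) :=
  Module.Basis.span (linearIndependent_szego.comp _ Subtype.val_injective)

theorem coe_da1_apply (Y : Finset Complex.UnitDisc) (y : Y) :
    ((da1 Y y : Submodule.span ℂ (Set.range fun y : Y => szego y)) : DA1) = szego y :=
  congrArg Subtype.val (Module.Basis.span_apply _ y)

/-- An r-Pick space is a rescaling of a Pick space `DA₁(Y)`, `Y` a finite subset of the disk. -/
def IsRPick {ι H : Type*} [NormedAddCommGroup H] [InnerProductSpace ℂ H]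
    (k : Module.Basis ι ℂ H) : Prop :=
  ∃ Y : Finset Complex.UnitDisc, IsRescaling k (da1 Y)

end Hardy

end FinRKHS

/-! The matrix `D_o(a, b) = 1 - k_ao k_ob / (k_ab k_oo)` satisfies `D_o(a, a) = δ_oa²`, and
`LF_oab = δ_ob` says `|D_o(a, b)| = δ_oa δ_ob`. The space is r-Pick exactly when
`D_o(a, b) = conj (f a) * f b` for some function `f`: for `DA₁(Y)` this `f` is the Blaschke factor
vanishing at `o`, and conversely `1 - conj (f a) * f b` is a reciprocal Szegő kernel up to
rescaling. Such an `f` on a subspace `H(Y)` satisfies `M_f M_f* = 1 - P_o` with `P_o` the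
projection onto `k_o`, so `M_f*` is isometric on `k_o^⊥`. A contractive extension `M_g` must invert
`M_g*` on this subspace, which forces `D_o(a, l) = conj (f a) * g l` at each further point `l`. For
`Y = {o, p, a}` the moduli alone make `D_o` of rank one, so the Pick property on four points gives
`D_o(a, b) * D_o(p, p) = D_o(a, p) * D_o(p, b)`. -/

namespace FinRKHS

open scoped ComplexConjugate

section Gram

variable {ι H : Type*} [NormedAddCommGroup H] [InnerProductSpace ℂ H]

theorem conj_gram (k : Module.Basis ι ℂ H) (i j : ι) : conj (gram k i j) = gram k j i :=
  inner_conj_symm _ _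

theorem gram_self (k : Module.Basis ι ℂ H) (i : ι) : gram k i i = (‖k i‖ : ℂ) ^ 2 :=
  inner_self_eq_norm_sq_to_K _

theorem gram_self_re (k : Module.Basis ι ℂ H) (i : ι) : (gram k i i).re = ‖k i‖ ^ 2 := by
  rw [gram_self]
  norm_cast

theorem gram_self_ne_zero (k : Module.Basis ι ℂ H) (i : ι) : gram k i i ≠ 0 :=
  inner_self_ne_zero.2 (k.ne_zero i)

theorem norm_gram_le (k : Module.Basis ι ℂ H) (i j : ι) : ‖gram k i j‖ ≤ ‖k i‖ * ‖k j‖ :=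
  (norm_inner_le_norm _ _).trans_eq (mul_comm _ _)

theorem norm_gram_lt (k : Module.Basis ι ℂ H) {i j : ι} (hij : i ≠ j) :
    ‖gram k i j‖ < ‖k i‖ * ‖k j‖ := by
  refine (norm_gram_le k i j).lt_of_ne fun heq => ?_
  rw [mul_comm] at heq
  obtain ⟨r, -, hr⟩ := (norm_inner_eq_norm_iff (k.ne_zero j) (k.ne_zero i)).1 heq
  have hrepr := congrArg (fun v => k.repr v i) hr
  simp [hij.symm] at hrepr

theorem IsIrreducible.gram_ne_zero {k : Module.Basis ι ℂ H} (hk : IsIrreducible k) (i j : ι) :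
    gram k i j ≠ 0 := by
  obtain rfl | hij := eq_or_ne i j
  exacts [gram_self_ne_zero k i, hk i j hij]

theorem gram_sub (k : Module.Basis ι ℂ H) (Y : Set ι) (x y : Y) :
    gram (sub k Y) x y = gram k x y := by
  simp only [gram, Submodule.coe_inner, coe_sub_apply]

theorem IsIrreducible.restrict {k : Module.Basis ι ℂ H} (hk : IsIrreducible k) (Y : Set ι) :
    IsIrreducible (sub k Y) := fun x y hxy => by
  rw [gram_sub]
  exact hk _ _ (Subtype.coe_ne_coe.2 hxy)

theorem delta_eq_sqrt (k : Module.Basis ι ℂ H) (i j : ι) :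
    delta k i j = √(1 - (‖gram k i j‖ / (‖k i‖ * ‖k j‖)) ^ 2) := by
  rw [delta, gram_self_re, gram_self_re, div_pow, mul_pow]

theorem delta_nonneg (k : Module.Basis ι ℂ H) (i j : ι) : 0 ≤ delta k i j := Real.sqrt_nonneg _

theorem delta_sub (k : Module.Basis ι ℂ H) (Y : Set ι) (x y : Y) :
    delta (sub k Y) x y = delta k x y := by
  simp only [delta, gram_sub]

theorem delta_sq (k : Module.Basis ι ℂ H) (i j : ι) :
    delta k i j ^ 2 = 1 - (‖gram k i j‖ / (‖k i‖ * ‖k j‖)) ^ 2 := by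
  rw [delta_eq_sqrt, Real.sq_sqrt]
  have hle : ‖gram k i j‖ / (‖k i‖ * ‖k j‖) ≤ 1 :=
    div_le_one_of_le₀ (norm_gram_le k i j) (by positivity)
  exact sub_nonneg.2 (pow_le_one₀ (by positivity) hle)

theorem delta_self (k : Module.Basis ι ℂ H) (i : ι) : delta k i i = 0 := by
  have hi : ‖k i‖ ^ 2 ≠ 0 := pow_ne_zero 2 (norm_ne_zero_iff.2 (k.ne_zero i))
  rw [delta_eq_sqrt, gram_self, norm_pow, Complex.norm_real, norm_norm, ← sq, div_self hi, one_pow,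
    sub_self, Real.sqrt_zero]

theorem delta_pos (k : Module.Basis ι ℂ H) {i j : ι} (hij : i ≠ j) : 0 < delta k i j := by
  have hi := norm_pos_iff.2 (k.ne_zero i)
  have hj := norm_pos_iff.2 (k.ne_zero j)
  rw [delta_eq_sqrt, Real.sqrt_pos, sub_pos]
  exact pow_lt_one₀ (by positivity) ((div_lt_one (by positivity)).2 (norm_gram_lt k hij))
    two_ne_zero

theorem IsIrreducible.delta_lt_one {k : Module.Basis ι ℂ H} (hk : IsIrreducible k) (i j : ι) :
    delta k i j < 1 := by
  have hi := norm_pos_iff.2 (k.ne_zero i)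
  have hj := norm_pos_iff.2 (k.ne_zero j)
  have hij := norm_pos_iff.2 (hk.gram_ne_zero i j)
  rw [delta_eq_sqrt, Real.sqrt_lt' one_pos, one_pow, sub_lt_self_iff]
  positivity

end Gram

section Defect

variable {ι H : Type*} [NormedAddCommGroup H] [InnerProductSpace ℂ H]

/-- The entry `D_o(a, b) = 1 - k_ao k_ob / (k_ab k_oo)` of the McCullough–Quiggin matrix with base
point `o`, whose positivity characterizes the complete Pick property. -/
noncomputable def defect (k : Module.Basis ι ℂ H) (o a b : ι) : ℂ :=
  1 - (gram k a o * gram k o b) / (gram k a b * gram k o o)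

theorem defect_sub (k : Module.Basis ι ℂ H) (Y : Set ι) (o a b : Y) :
    defect (sub k Y) o a b = defect k o a b := by
  simp only [defect, gram_sub]

theorem conj_defect (k : Module.Basis ι ℂ H) (o a b : ι) :
    conj (defect k o a b) = defect k o b a := by
  simp only [defect, map_sub, map_one, map_div₀, map_mul, conj_gram]
  ring

theorem norm_defect_comm (k : Module.Basis ι ℂ H) (o a b : ι) :
    ‖defect k o a b‖ = ‖defect k o b a‖ := by
  rw [← conj_defect, RCLike.norm_conj]

theorem defect_self (k : Module.Basis ι ℂ H) (o a : ι) :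
    defect k o a a = (delta k o a : ℂ) ^ 2 := by
  rw [← Complex.ofReal_pow, delta_sq, defect, ← conj_gram k o a, Complex.conj_mul', gram_self,
    gram_self]
  push_cast
  rw [div_pow, mul_pow, mul_comm ((‖k a‖ : ℂ) ^ 2)]

theorem norm_defect_self (k : Module.Basis ι ℂ H) (o a : ι) :
    ‖defect k o a a‖ = delta k o a * delta k o a := by
  rw [defect_self, norm_pow, Complex.norm_of_nonneg (delta_nonneg k o a), sq]

theorem IsIrreducible.defect_base_left {k : Module.Basis ι ℂ H} (hk : IsIrreducible k) (o b : ι) :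
    defect k o o b = 0 := by
  rw [defect, mul_comm, div_self (mul_ne_zero (hk.gram_ne_zero o b) (gram_self_ne_zero k o)),
    sub_self]

theorem IsIrreducible.defect_base_right {k : Module.Basis ι ℂ H} (hk : IsIrreducible k) (o a : ι) :
    defect k o a o = 0 := by
  rw [← conj_defect, hk.defect_base_left, map_zero]

theorem IsIrreducible.gram_mul_one_sub_defect {k : Module.Basis ι ℂ H} (hk : IsIrreducible k)
    (o a b : ι) : gram k a b * (1 - defect k o a b) = gram k a o * gram k o b / gram k o o := by
  rw [defect, sub_sub_cancel, ← div_div, mul_div_assoc', mul_div_cancel₀ _ (hk.gram_ne_zero a b)]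

theorem LF_eq_delta_iff (k : Module.Basis ι ℂ H) {o a : ι} (hoa : o ≠ a) (b : ι) :
    LF k o a b = delta k o b ↔ ‖defect k o a b‖ = delta k o a * delta k o b := by
  rw [LF, ← defect, one_div, inv_mul_eq_iff_eq_mul₀ (delta_pos k hoa).ne']

theorem IsIrreducible.norm_defect_eq_of_LF_eq [LinearOrder ι] {k : Module.Basis ι ℂ H}
    (hk : IsIrreducible k) {o : ι} (ho : ∀ a, o ≤ a)
    (hLF : ∀ a b, o < a → a < b → LF k o a b = delta k o b) (a b : ι) :
    ‖defect k o a b‖ = delta k o a * delta k o b := by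
  wlog hab : a ≤ b generalizing a b
  · rw [norm_defect_comm, mul_comm, this b a (le_of_not_ge hab)]
  obtain rfl | hoa := (ho a).eq_or_lt
  · rw [hk.defect_base_left, delta_self, norm_zero, zero_mul]
  obtain rfl | hab := hab.eq_or_lt
  · exact norm_defect_self k o a
  · exact (LF_eq_delta_iff k hoa.ne b).1 (hLF a b hoa hab)

/-- The function `f` represents the McCullough–Quiggin matrix with base point `o` as a rank one
Gram matrix. It plays the role of a coordinate in the disk that sends `o` to `0`. -/
def IsDefectFactor (k : Module.Basis ι ℂ H) (o : ι) (f : ι → ℂ) : Prop :=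
  ∀ a b, defect k o a b = conj (f a) * f b

namespace IsDefectFactor

variable {k : Module.Basis ι ℂ H} {o : ι} {f : ι → ℂ}

theorem norm_eq_delta (hf : IsDefectFactor k o f) (a : ι) : ‖f a‖ = delta k o a := by
  have hsq : (‖f a‖ : ℂ) ^ 2 = (delta k o a : ℂ) ^ 2 := by
    rw [← Complex.conj_mul', ← hf, defect_self]
  exact (sq_eq_sq₀ (norm_nonneg _) (delta_nonneg _ _ _)).1 (by exact_mod_cast hsq)

theorem map_base (hf : IsDefectFactor k o f) : f o = 0 := by
  rw [← norm_eq_zero, hf.norm_eq_delta, delta_self]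

theorem norm_defect (hf : IsDefectFactor k o f) (a b : ι) :
    ‖defect k o a b‖ = delta k o a * delta k o b := by
  rw [hf, norm_mul, RCLike.norm_conj, hf.norm_eq_delta, hf.norm_eq_delta]

theorem norm_lt_one (hk : IsIrreducible k) (hf : IsDefectFactor k o f) (a : ι) : ‖f a‖ < 1 :=
  (hf.norm_eq_delta a).trans_lt (hk.delta_lt_one o a)

theorem gram_mul (hk : IsIrreducible k) (hf : IsDefectFactor k o f) (a b : ι) :
    gram k a b * (1 - conj (f a) * f b) = gram k a o * gram k o b / gram k o o := by
  rw [← hf, hk.gram_mul_one_sub_defect]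

end IsDefectFactor

end Defect

section Contraction

variable {𝕜 E F : Type*} [RCLike 𝕜] [NormedAddCommGroup E] [InnerProductSpace 𝕜 E]
  [NormedAddCommGroup F] [InnerProductSpace 𝕜 F] {S : E → F} {T : F → E}

theorem norm_le_of_inner_eq_of_norm_le (hST : ∀ x y, inner 𝕜 (S x) y = inner 𝕜 x (T y))
    (hS : ∀ x, ‖S x‖ ≤ ‖x‖) (y : F) : ‖T y‖ ≤ ‖y‖ := by
  have hsq : ‖T y‖ * ‖T y‖ ≤ ‖T y‖ * ‖y‖ :=
    calc ‖T y‖ * ‖T y‖ = RCLike.re (inner 𝕜 (S (T y)) y) := by rw [hST, inner_self_eq_norm_mul_norm]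
      _ ≤ ‖S (T y)‖ * ‖y‖ := re_inner_le_norm _ _
      _ ≤ ‖T y‖ * ‖y‖ := by gcongr; exact hS _
  nlinarith [norm_nonneg y]

theorem apply_apply_eq_self_of_norm_eq (hST : ∀ x y, inner 𝕜 (S x) y = inner 𝕜 x (T y))
    (hT : ∀ y, ‖T y‖ ≤ ‖y‖) {x : E} (hx : ‖S x‖ = ‖x‖) : T (S x) = x := by
  refine eq_of_norm_le_re_inner_eq_norm_sq (𝕜 := 𝕜) ((hT _).trans_eq hx) ?_
  rw [inner_re_symm, ← hST, inner_self_eq_norm_sq, hx]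

end Contraction

section Multiplier

theorem norm_piLp_fin_one {E : Type*} [SeminormedAddCommGroup E] (x : PiLp 2 fun _ : Fin 1 => E) :
    ‖x‖ = ‖x 0‖ := by
  rw [PiLp.norm_eq_of_L2, Fin.sum_univ_one, Real.sqrt_sq (norm_nonneg _)]

variable {ι H : Type*} [NormedAddCommGroup H] [InnerProductSpace ℂ H]

/-- The scalar multiplier operator `M_f`, acting on `H` itself. -/
noncomputable def scalarMult [Finite ι] (k : Module.Basis ι ℂ H) (f : ι → ℂ) : H →ₗ[ℂ] H :=
  (evalEquiv k).symm.conj (LinearMap.mulLeft ℂ f)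

/-- The adjoint of `scalarMult k f`, for which the kernel functions are eigenvectors. -/
noncomputable def scalarMultAdjoint (k : Module.Basis ι ℂ H) (f : ι → ℂ) : H →ₗ[ℂ] H :=
  k.constr ℂ fun i => conj (f i) • k i

theorem scalarMultAdjoint_apply_basis (k : Module.Basis ι ℂ H) (f : ι → ℂ) (i : ι) :
    scalarMultAdjoint k f (k i) = conj (f i) • k i := k.constr_basis ℂ _ i

theorem coe_scalarMultAdjoint_sub (k : Module.Basis ι ℂ H) (Y : Set ι) (f : ι → ℂ)
    (v : Submodule.span ℂ (Set.range fun y : Y => k y)) :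
    (scalarMultAdjoint (sub k Y) (fun y => f y) v : H) = scalarMultAdjoint k f v := by
  have h : Submodule.subtype _ ∘ₗ scalarMultAdjoint (sub k Y) (fun y => f y) =
      scalarMultAdjoint k f ∘ₗ Submodule.subtype _ := (sub k Y).ext fun y => by
    simp only [LinearMap.comp_apply, Submodule.subtype_apply, scalarMultAdjoint_apply_basis,
      Submodule.coe_smul, coe_sub_apply]
  exact LinearMap.congr_fun h v

variable [Finite ι]

theorem inner_scalarMult (k : Module.Basis ι ℂ H) (f : ι → ℂ) (i : ι) (h : H) :
    inner ℂ (k i) (scalarMult k f h) = f i * inner ℂ (k i) h :=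
  congrFun ((evalEquiv k).apply_symm_apply (f * evalEquiv k h)) i

theorem inner_scalarMultAdjoint (k : Module.Basis ι ℂ H) (f : ι → ℂ) (v h : H) :
    inner ℂ (scalarMultAdjoint k f v) h = inner ℂ v (scalarMult k f h) := by
  have hext : (innerₛₗ ℂ).flip h ∘ₛₗ scalarMultAdjoint k f =
      (innerₛₗ ℂ).flip (scalarMult k f h) := k.ext fun i => by
    simp only [LinearMap.comp_apply, LinearMap.flip_apply, innerₛₗ_apply_apply,
      scalarMultAdjoint_apply_basis, inner_smul_left, inner_scalarMult, RCLike.conj_conj]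
  exact LinearMap.congr_fun hext v

theorem norm_multOp_apply (k : Module.Basis ι ℂ H) (F : ι → Matrix (Fin 1) (Fin 1) ℂ)
    (h : PiLp 2 fun _ : Fin 1 => H) :
    ‖multOp k F h‖ = ‖scalarMult k (fun i => F i 0 0) (h 0)‖ := by
  rw [norm_piLp_fin_one]
  simp only [multOp, LinearMap.coe_mk, AddHom.coe_mk, Matrix.mulVec, dotProduct, Fin.sum_univ_one]
  rfl

theorem norm_scalarMult_le_multNorm_mul (k : Module.Basis ι ℂ H)
    (F : ι → Matrix (Fin 1) (Fin 1) ℂ) (h : H) :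
    ‖scalarMult k (fun i => F i 0 0) h‖ ≤ multNorm k F * ‖h‖ := by
  have : FiniteDimensional ℂ H := k.finiteDimensional_of_finite
  have hle := (LinearMap.toContinuousLinearMap (multOp k F)).le_opNorm (WithLp.toLp 2 fun _ => h)
  rwa [LinearMap.coe_toContinuousLinearMap', norm_multOp_apply, norm_piLp_fin_one] at hle

theorem multNorm_le_of_norm_scalarMult_le (k : Module.Basis ι ℂ H)
    (F : ι → Matrix (Fin 1) (Fin 1) ℂ) {C : ℝ} (hC : 0 ≤ C)
    (hF : ∀ h, ‖scalarMult k (fun i => F i 0 0) h‖ ≤ C * ‖h‖) : multNorm k F ≤ C := by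
  have : FiniteDimensional ℂ H := k.finiteDimensional_of_finite
  refine ContinuousLinearMap.opNorm_le_bound _ hC fun h => ?_
  rw [LinearMap.coe_toContinuousLinearMap', norm_multOp_apply, norm_piLp_fin_one]
  exact hF (h 0)

/-- The (scalar) Pick property, the case `s = t = 1` of `HasCPP`. -/
def HasPickProperty (k : Module.Basis ι ℂ H) : Prop :=
  ∀ (Y : Set ι) (F : Y → Matrix (Fin 1) (Fin 1) ℂ), multNorm (sub k Y) F = 1 →
    ∃ G : ι → Matrix (Fin 1) (Fin 1) ℂ, (∀ y : Y, G y = F y) ∧ multNorm k G = 1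

theorem HasCPP.hasPickProperty {k : Module.Basis ι ℂ H} (hk : HasCPP k) : HasPickProperty k :=
  fun Y => hk Y 1 1

end Multiplier

section Extension

variable {ι H : Type*} [NormedAddCommGroup H] [InnerProductSpace ℂ H]

/-- A combination of `k b` and `k o` that is orthogonal to `k o`. The multiple of the orthogonal
projection of `k b` is chosen so that no denominators appear. -/
noncomputable def orthKernel (k : Module.Basis ι ℂ H) (o b : ι) : H :=
  gram k o o • k b - gram k b o • k o

theorem inner_orthKernel (k : Module.Basis ι ℂ H) (o b l : ι) :
    inner ℂ (k l) (orthKernel k o b) = gram k o o * gram k b l - gram k b o * gram k o l := by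
  rw [orthKernel, inner_sub_right, inner_smul_right, inner_smul_right]
  rfl

theorem inner_base_orthKernel (k : Module.Basis ι ℂ H) (o b : ι) :
    inner ℂ (k o) (orthKernel k o b) = 0 := by
  rw [inner_orthKernel, mul_comm, sub_self]

theorem orthKernel_ne_zero (k : Module.Basis ι ℂ H) {o b : ι} (hbo : b ≠ o) :
    orthKernel k o b ≠ 0 := fun h => by
  have hrepr := congrArg (fun v => k.repr v b) h
  simp [orthKernel, hbo.symm, gram_self_ne_zero] at hrepr

theorem coe_orthKernel_sub (k : Module.Basis ι ℂ H) (Y : Set ι) (o b : Y) :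
    ((orthKernel (sub k Y) o b : Submodule.span ℂ (Set.range fun y : Y => k y)) : H) =
      orthKernel k o b := by
  simp only [orthKernel, Submodule.coe_sub, Submodule.coe_smul, coe_sub_apply, gram_sub]

variable [Finite ι]

namespace IsDefectFactor

variable {k : Module.Basis ι ℂ H} {o : ι} {f : ι → ℂ}

theorem scalarMult_scalarMultAdjoint (hk : IsIrreducible k) (hf : IsDefectFactor k o f) (v : H) :
    scalarMult k f (scalarMultAdjoint k f v) = v - (inner ℂ (k o) v / gram k o o) • k o := by
  have hext : scalarMult k f ∘ₗ scalarMultAdjoint k f =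
      LinearMap.id - ((gram k o o)⁻¹ • innerₛₗ ℂ (k o)).smulRight (k o) := by
    refine k.ext fun a => evalLin_injective k (funext fun b => ?_)
    change inner ℂ (k b) (scalarMult k f (scalarMultAdjoint k f (k a))) =
      inner ℂ (k b) (k a - ((gram k o o)⁻¹ * gram k a o) • k o)
    rw [scalarMultAdjoint_apply_basis, inner_scalarMult, inner_smul_right, inner_sub_right,
      inner_smul_right]
    change f b * (conj (f a) * gram k a b) = gram k a b - (gram k o o)⁻¹ * gram k a o * gram k o b
    linear_combination -hf.gram_mul hk a b
  rw [div_eq_inv_mul]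
  exact LinearMap.congr_fun hext v

theorem norm_sq_scalarMultAdjoint (hk : IsIrreducible k) (hf : IsDefectFactor k o f) (v : H) :
    ‖scalarMultAdjoint k f v‖ ^ 2 = ‖v‖ ^ 2 - ‖inner ℂ (k o) v‖ ^ 2 / ‖k o‖ ^ 2 := by
  have h := inner_scalarMultAdjoint k f v (scalarMultAdjoint k f v)
  rw [hf.scalarMult_scalarMultAdjoint hk, inner_sub_right, inner_smul_right,
    inner_self_eq_norm_sq_to_K, inner_self_eq_norm_sq_to_K, div_mul_eq_mul_div,
    ← inner_conj_symm v (k o), RCLike.mul_conj, gram_self] at h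
  apply Complex.ofReal_injective
  push_cast
  exact h

theorem norm_scalarMultAdjoint_le (hk : IsIrreducible k) (hf : IsDefectFactor k o f) (v : H) :
    ‖scalarMultAdjoint k f v‖ ≤ ‖v‖ := by
  refine (sq_le_sq₀ (norm_nonneg _) (norm_nonneg _)).1 ?_
  rw [hf.norm_sq_scalarMultAdjoint hk]
  exact sub_le_self _ (by positivity)

theorem norm_scalarMultAdjoint_of_inner_eq_zero (hk : IsIrreducible k)
    (hf : IsDefectFactor k o f) {v : H} (hv : inner ℂ (k o) v = 0) :
    ‖scalarMultAdjoint k f v‖ = ‖v‖ := by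
  refine (sq_eq_sq₀ (norm_nonneg _) (norm_nonneg _)).1 ?_
  rw [hf.norm_sq_scalarMultAdjoint hk, hv, norm_zero, zero_pow two_ne_zero, zero_div, sub_zero]

theorem multNorm_eq_one [Nontrivial ι] (hk : IsIrreducible k) (hf : IsDefectFactor k o f) :
    multNorm k (fun i => !![f i]) = 1 := by
  refine le_antisymm (multNorm_le_of_norm_scalarMult_le k _ zero_le_one fun h => ?_) ?_
  · rw [one_mul]
    exact norm_le_of_inner_eq_of_norm_le (inner_scalarMultAdjoint k f)
      (hf.norm_scalarMultAdjoint_le hk) h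
  · obtain ⟨b, hbo⟩ := exists_ne o
    set v := orthKernel k o b
    have hv : inner ℂ (k o) v = 0 := inner_base_orthKernel k o b
    have hle := norm_scalarMult_le_multNorm_mul k (fun i => !![f i]) (scalarMultAdjoint k f v)
    change ‖scalarMult k f (scalarMultAdjoint k f v)‖ ≤ _ at hle
    rw [hf.scalarMult_scalarMultAdjoint hk, hv, zero_div, zero_smul, sub_zero,
      hf.norm_scalarMultAdjoint_of_inner_eq_zero hk hv] at hle
    exact (le_mul_iff_one_le_left (norm_pos_iff.2 (orthKernel_ne_zero k hbo))).1 hle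

end IsDefectFactor

theorem HasPickProperty.exists_defect_eq {k : Module.Basis ι ℂ H} (hk : IsIrreducible k)
    (hpp : HasPickProperty k) {Y : Set ι} [Nontrivial Y] {o : Y} {f : Y → ℂ}
    (hf : IsDefectFactor (sub k Y) o f) :
    ∃ g : ι → ℂ, ∀ (b : Y) (l : ι), defect k o b l = conj (f b) * g l := by
  obtain ⟨G, hG, hnorm⟩ := hpp Y _ (hf.multNorm_eq_one (hk.restrict Y))
  set g : ι → ℂ := fun i => G i 0 0 with hg
  obtain rfl : f = fun y : Y => g y := funext fun y => by simp [hg, hG]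
  refine ⟨g, fun b l => ?_⟩
  have hcontr (h : H) : ‖scalarMult k g h‖ ≤ ‖h‖ := by
    simpa only [hnorm, one_mul] using norm_scalarMult_le_multNorm_mul k G h
  have hisom : ‖scalarMultAdjoint k g (orthKernel k o b)‖ = ‖orthKernel k o b‖ := by
    rw [← coe_orthKernel_sub, ← coe_scalarMultAdjoint_sub]
    exact hf.norm_scalarMultAdjoint_of_inner_eq_zero (hk.restrict Y) (inner_base_orthKernel _ o b)
  have hadj : scalarMultAdjoint k g (orthKernel k o b) =
      (gram k o o * conj (g b)) • k b := by
    rw [orthKernel, map_sub, map_smul, map_smul, scalarMultAdjoint_apply_basis,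
      scalarMultAdjoint_apply_basis, hf.map_base, map_zero, zero_smul, smul_zero, sub_zero,
      smul_smul]
  have hinv : g l * (gram k o o * conj (g b) * gram k b l) =
      gram k o o * gram k b l - gram k b o * gram k o l := by
    rw [← inner_orthKernel,
      ← apply_apply_eq_self_of_norm_eq (inner_scalarMultAdjoint k g) hcontr hisom,
      inner_scalarMult, hadj, inner_smul_right]
    rfl
  have hbl := hk.gram_ne_zero b l
  have hoo := gram_self_ne_zero k (o : ι)
  rw [defect]
  field_simp
  linear_combination -hinv

end Extension

section FourPoint

variable {ι H : Type*} [NormedAddCommGroup H] [InnerProductSpace ℂ H]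
  {k : Module.Basis ι ℂ H} {o p a b : ι}

theorem defect_eq_conj_mul_iff (hop : o ≠ p) :
    defect k o a b = conj (defect k o p a / delta k o p) * (defect k o p b / delta k o p) ↔
      defect k o a b * defect k o p p = defect k o a p * defect k o p b := by
  have hp : (delta k o p : ℂ) ≠ 0 := Complex.ofReal_ne_zero.2 (delta_pos k hop).ne'
  rw [map_div₀, conj_defect, Complex.conj_ofReal, div_mul_div_comm, eq_div_iff (mul_ne_zero hp hp),
    defect_self, sq]

theorem IsIrreducible.defect_mul_defect_self_of_degenerate (hk : IsIrreducible k)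
    (hab : a = o ∨ b = o ∨ a = p ∨ b = p) :
    defect k o a b * defect k o p p = defect k o a p * defect k o p b := by
  rcases hab with rfl | rfl | rfl | rfl
  · rw [hk.defect_base_left, hk.defect_base_left, zero_mul, zero_mul]
  · rw [hk.defect_base_right, hk.defect_base_right, zero_mul, mul_zero]
  · exact mul_comm _ _
  · rfl

theorem defect_self_mul_defect_self (h : ‖defect k o p a‖ = delta k o p * delta k o a) :
    defect k o a a * defect k o p p = defect k o a p * defect k o p a := by
  rw [← conj_defect k o p a, Complex.conj_mul', h, defect_self, defect_self, Complex.ofReal_mul,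
    mul_pow, mul_comm]

theorem IsIrreducible.isDefectFactor_triple (hk : IsIrreducible k) (hop : o ≠ p)
    (h : ‖defect k o p a‖ = delta k o p * delta k o a) :
    IsDefectFactor (sub k {o, p, a}) ⟨o, by simp⟩ fun y => defect k o p y / delta k o p := by
  rintro ⟨x, hx⟩ ⟨y, hy⟩
  rw [defect_sub, defect_eq_conj_mul_iff hop]
  by_cases hxy : x = o ∨ y = o ∨ x = p ∨ y = p
  · exact hk.defect_mul_defect_self_of_degenerate hxy
  · obtain ⟨rfl, rfl⟩ : x = a ∧ y = a := by
      simp only [Set.mem_insert_iff, Set.mem_singleton_iff] at hx hy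
      tauto
    exact defect_self_mul_defect_self h

theorem HasPickProperty.defect_mul_defect_self [Finite ι] (hk : IsIrreducible k)
    (hpp : HasPickProperty k) (h : ‖defect k o p a‖ = delta k o p * delta k o a) (b : ι) :
    defect k o a b * defect k o p p = defect k o a p * defect k o p b := by
  obtain rfl | hop := eq_or_ne o p
  · rw [hk.defect_base_left, hk.defect_base_left, mul_zero, mul_zero]
  have : Nontrivial ({o, p, a} : Set ι) :=
    Set.nontrivial_coe_sort.2 ⟨o, by simp, p, by simp, hop⟩
  obtain ⟨g, hg⟩ := hpp.exists_defect_eq hk (hk.isDefectFactor_triple hop h)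
  obtain ⟨c, hp⟩ : ∃ c, ∀ l, defect k o p l = c * g l := ⟨_, hg ⟨p, by simp⟩⟩
  obtain ⟨d, ha⟩ : ∃ d, ∀ l, defect k o a l = d * g l := ⟨_, hg ⟨a, by simp⟩⟩
  rw [ha, ha, hp, hp]
  ring

theorem IsIrreducible.defect_mul_defect_self [Finite ι] (hk : IsIrreducible k)
    (hpp : ∀ Λ : Set ι, Λ.ncard = 4 → HasPickProperty (sub k Λ))
    (hop : o ≠ p) (h : ‖defect k o p a‖ = delta k o p * delta k o a) (b : ι) :
    defect k o a b * defect k o p p = defect k o a p * defect k o p b := by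
  by_cases hdeg : a = o ∨ b = o ∨ a = p ∨ b = p
  · exact hk.defect_mul_defect_self_of_degenerate hdeg
  obtain rfl | hab := eq_or_ne a b
  · exact defect_self_mul_defect_self h
  push Not at hdeg
  obtain ⟨hao, hbo, hap, hbp⟩ := hdeg
  have hcard : ({o, p, a, b} : Set ι).ncard = 4 := by
    rw [Set.ncard_insert_of_notMem (by simp [hop, hao.symm, hbo.symm]),
      Set.ncard_insert_of_notMem (by simp [hap.symm, hbp.symm]), Set.ncard_pair hab]
  have hsub := (hpp _ hcard).defect_mul_defect_self (hk.restrict _) (o := ⟨o, by simp⟩)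
    (p := ⟨p, by simp⟩) (a := ⟨a, by simp⟩) (by simpa only [defect_sub, delta_sub] using h)
    ⟨b, by simp⟩
  simpa only [defect_sub] using hsub

theorem IsIrreducible.exists_isDefectFactor [Finite ι] (hk : IsIrreducible k)
    (hpp : ∀ Λ : Set ι, Λ.ncard = 4 → HasPickProperty (sub k Λ))
    (h : ∀ a b, ‖defect k o a b‖ = delta k o a * delta k o b) : ∃ f, IsDefectFactor k o f := by
  cases subsingleton_or_nontrivial ι
  · refine ⟨0, fun a b => ?_⟩
    rw [Subsingleton.elim a o, hk.defect_base_left, Pi.zero_apply, map_zero, zero_mul]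
  · obtain ⟨p, hpo⟩ := exists_ne o
    exact ⟨_, fun a b => (defect_eq_conj_mul_iff hpo.symm).2
      (hk.defect_mul_defect_self hpp hpo.symm (h p a) b)⟩

end FourPoint

section RPick

theorem one_sub_conj_mul_ne_zero {z w : ℂ} (hz : ‖z‖ < 1) (hw : ‖w‖ < 1) : 1 - conj z * w ≠ 0 := by
  refine sub_ne_zero.2 fun h => ?_
  have hlt : ‖conj z * w‖ < 1 := by
    rw [norm_mul, RCLike.norm_conj]
    exact mul_lt_one_of_nonneg_of_lt_one_left (norm_nonneg _) hz hw.le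
  rw [← h, norm_one] at hlt
  exact hlt.false

theorem gram_da1 (Y : Finset Complex.UnitDisc) (x y : Y) :
    gram (da1 Y) x y = (1 - conj (x : ℂ) * y)⁻¹ := by
  rw [gram, Submodule.coe_inner, coe_da1_apply, coe_da1_apply, inner_szego_szego, one_div,
    mul_comm]

theorem isDefectFactor_da1 (Y : Finset Complex.UnitDisc) (o : Y) :
    IsDefectFactor (da1 Y) o fun a => ((a : ℂ) - o) / (1 - conj (o : ℂ) * a) := fun a b => by
  have hne (x y : Y) : 1 - conj (x : ℂ) * y ≠ 0 :=
    one_sub_conj_mul_ne_zero (Complex.UnitDisc.norm_lt_one _) (Complex.UnitDisc.norm_lt_one _)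
  have hao := hne a o
  have hob := hne o b
  simp only [defect, gram_da1, map_div₀, map_sub, map_one, map_mul, RCLike.conj_conj]
  field_simp
  ring

variable {ι H : Type*} [NormedAddCommGroup H] [InnerProductSpace ℂ H] {k : Module.Basis ι ℂ H}

theorem defect_eq_of_gram_eq {ι' H' : Type*} [NormedAddCommGroup H'] [InnerProductSpace ℂ H']
    {k' : Module.Basis ι' ℂ H'} {Ξ : ι → ι'} {γ : ι → ℂ} (hγ : ∀ x, γ x ≠ 0)
    (h : ∀ x y, gram k' (Ξ x) (Ξ y) = γ x * conj (γ y) * gram k x y) (o a b : ι) :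
    defect k o a b = defect k' (Ξ o) (Ξ a) (Ξ b) := by
  have hγ' (x : ι) : conj (γ x) ≠ 0 := (map_ne_zero _).2 (hγ x)
  have hscale : γ a * conj (γ b) * γ o * conj (γ o) ≠ 0 :=
    mul_ne_zero (mul_ne_zero (mul_ne_zero (hγ a) (hγ' b)) (hγ o)) (hγ' o)
  rw [defect, defect, h, h, h, h, ← mul_div_mul_left _ _ hscale]
  ring

theorem IsRPick.exists_isDefectFactor (hk : IsRPick k) (o : ι) : ∃ f, IsDefectFactor k o f := by
  obtain ⟨Y, Ξ, γ, hγ, hΞ⟩ := hk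
  exact ⟨_, fun a b => (defect_eq_of_gram_eq hγ hΞ o a b).trans (isDefectFactor_da1 Y (Ξ o) _ _)⟩

theorem IsRPick.LF_eq_delta (hk : IsRPick k) {o a : ι} (hoa : o ≠ a) (b : ι) :
    LF k o a b = delta k o b := by
  obtain ⟨f, hf⟩ := hk.exists_isDefectFactor o
  exact (LF_eq_delta_iff k hoa b).2 (hf.norm_defect a b)

theorem IsDefectFactor.injective {o : ι} {f : ι → ℂ} (hk : IsIrreducible k)
    (hf : IsDefectFactor k o f) : Function.Injective f := fun a b hab => by
  have hparallel : gram k b o • k a = gram k a o • k b := by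
    refine evalLin_injective k (funext fun c => ?_)
    change inner ℂ (k c) (gram k b o • k a) = inner ℂ (k c) (gram k a o • k b)
    rw [inner_smul_right, inner_smul_right]
    change gram k b o * gram k a c = gram k a o * gram k b c
    have hac := hf.gram_mul hk a c
    have hbc := hf.gram_mul hk b c
    rw [← hab] at hbc
    refine mul_right_cancel₀ (one_sub_conj_mul_ne_zero (hf.norm_lt_one hk a)
      (hf.norm_lt_one hk c)) ?_
    linear_combination gram k b o * hac - gram k a o * hbc
  by_contra hne
  have hrepr := congrArg (fun v => k.repr v a) hparallel
  simp [Ne.symm hne, hk.gram_ne_zero b o] at hrepr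

theorem isRPick_of_injective [Finite ι] {f γ : ι → ℂ} (hf : Function.Injective f)
    (hlt : ∀ a, ‖f a‖ < 1) (hγ : ∀ a, γ a ≠ 0)
    (hgram : ∀ a b, γ a * conj (γ b) * gram k a b = (1 - conj (f a) * f b)⁻¹) : IsRPick k := by
  let z (a : ι) : Complex.UnitDisc := .mk (f a) (hlt a)
  have hz : Function.Injective z := fun a b hab => hf ((Complex.UnitDisc.mk_inj _ _).1 hab)
  let e : ι ≃ (Set.finite_range z).toFinset :=
    (Equiv.ofInjective z hz).trans (Equiv.setCongr (Set.finite_range z).coe_toFinset.symm)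
  refine ⟨_, e, γ, hγ, fun a b => ?_⟩
  rw [gram_da1, hgram]
  rfl

theorem IsDefectFactor.isRPick [Finite ι] {o : ι} {f : ι → ℂ} (hk : IsIrreducible k)
    (hf : IsDefectFactor k o f) : IsRPick k := by
  have hko : (‖k o‖ : ℂ) ≠ 0 := Complex.ofReal_ne_zero.2 (norm_ne_zero_iff.2 (k.ne_zero o))
  refine isRPick_of_injective (γ := fun a => ‖k o‖ / gram k a o) (hf.injective hk)
    (hf.norm_lt_one hk) (fun a => div_ne_zero hko (hk.gram_ne_zero a o)) fun a b => ?_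
  have hao := hk.gram_ne_zero a o
  have hob := hk.gram_ne_zero o b
  have hab := hf.gram_mul hk a b
  rw [gram_self, eq_div_iff (pow_ne_zero 2 hko)] at hab
  rw [map_div₀, Complex.conj_ofReal, conj_gram]
  refine eq_inv_of_mul_eq_one_left ?_
  field_simp
  linear_combination hab

theorem isRPick_of_isEmpty [IsEmpty ι] (k : Module.Basis ι ℂ H) : IsRPick k :=
  isRPick_of_injective (f := isEmptyElim) (γ := isEmptyElim) (Function.injective_of_subsingleton _)
    isEmptyElim isEmptyElim isEmptyElim

end RPick

end FinRKHS

theorem proposition6p10_general {ι H : Type*} [Finite ι] [LinearOrder ι] [NormedAddCommGroup H]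
    [InnerProductSpace ℂ H] (k : Module.Basis ι ℂ H) (hirr : FinRKHS.IsIrreducible k)
    (hpp : ∀ Λ : Set ι, Λ.ncard = 4 → FinRKHS.HasPickProperty (FinRKHS.sub k Λ)) :
    FinRKHS.IsRPick k ↔
      ∀ i j l : ι, i < j → j < l → FinRKHS.LF k i j l = FinRKHS.delta k i l := by
  refine ⟨fun hpick i j l hij _ => hpick.LF_eq_delta hij.ne l, fun hLF => ?_⟩
  cases isEmpty_or_nonempty ι
  · exact FinRKHS.isRPick_of_isEmpty k
  · obtain ⟨o, ho⟩ := Finite.exists_min (id : ι → ι)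
    obtain ⟨f, hf⟩ := hirr.exists_isDefectFactor hpp (hirr.norm_defect_eq_of_LF_eq ho (hLF o))
    exact hf.isRPick hirr

theorem proposition6p10 (m : ℕ) (hm : 4 ≤ m) {H : Type*} [NormedAddCommGroup H]
    [InnerProductSpace ℂ H] (k : Module.Basis (Fin m) ℂ H)
    (hirr : FinRKHS.IsIrreducible k)
    (hcpp : ∀ Λ : Set (Fin m), Λ.ncard = 4 → FinRKHS.HasCPP (FinRKHS.sub k Λ)) :
    FinRKHS.IsRPick k ↔
      ∀ i j l : Fin m, i < j → j < l → FinRKHS.LF k i j l = FinRKHS.delta k i l :=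
  proposition6p10_general k hirr fun Λ hΛ => (hcpp Λ hΛ).hasPickProperty
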